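/- Let $A$ be any of the real $*$-algebras $\mathbb C,\mathbb H,\mathbb O$ (complex numbers, quaternions, octonions), with conjugation $x\mapsto x^c$, and let $\mathbb S=\{J\in A : J+J^c=0,\ JJ^c=1\}$ be its sphere of imaginary units. For $E\subseteq\mathbb C$ put $\Omega_E=\{\alpha+\beta J : \alpha,\beta\in\mathbb R,\ J\in\mathbb S,\ \alpha+i\beta\in E\}\subseteq A$; a subset of $A$ is called circular if it equals $\Omega_E$ for some $E\subseteq\mathbb C$. Let $\Omega=\Omega_D$ be a circular set, where $D\subseteq\mathbb C$ is invariant under complex conjugation. A function $f:\Omega\to A$ is a slice function if there are $F_1,F_2:D\to A$ with $F_1(\bar z)=F_1(z)$, $F_2(\bar z)=-F_2(z)$ and $f(\alpha+\beta J)=F_1(\alpha+i\beta)+J\,F_2(\alpha+i\beta)$ for all $\alpha+i\beta\in D$, $J\in\mathbb S$; the pair $F=F_1+\iota F_2$ (the stem function of $f$) is then unique. Let $\mathcal S(\Omega)$ be the set of slice functions on $\Omega$. If $f,g\in\mathcal S(\Omega)$ have stem functions $F_1+\iota F_2$ and $G_1+\iota G_2$, then the slice product $f\cdot g$ and the slice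 conjugate $f^c$ are the slice functions with stem functions $(F_1G_1-F_2G_2)+\iota(F_1G_2+F_2G_1)$ and $F_1^c+\iota F_2^c$, and $N(f)=f\cdot f^c$. For $h\in\mathcal S(\Omega)$ let $V(h)=\{x\in\Omega : h(x)=0\}$. Let $f\in\mathcal S(\Omega)$ and $\Omega':=\Omega\setminus V(N(f))$. If $\Omega'\neq\emptyset$, then $f|_{\Omega'}$ has a unique two-sided inverse $f^{-\bullet}$ in $\mathcal S(\Omega')$ with respect to the slice product. If $C$ is a nonempty circular subset of $\Omega'$, then $f(x)\neq 0$ for all $x\in C$, and $$f^{-\bullet}(C)=\{f(x)^{-1} : x\in C\}.$$ -/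

import Mathlib

open scoped Quaternion ComplexConjugate

/-! ## The octonions -/

/-- The algebra `𝕆 = ℍ + ℓ ℍ` of octonions: `⟨α, β⟩` stands for `α + ℓ β`. -/
@[ext]
structure Octonion where
  fst : ℍ[ℝ]
  snd : ℍ[ℝ]

noncomputable section

namespace Octonion

instance : Zero Octonion := ⟨⟨0, 0⟩⟩
instance : Add Octonion := ⟨fun x y => ⟨x.fst + y.fst, x.snd + y.snd⟩⟩
instance : Neg Octonion := ⟨fun x => ⟨-x.fst, -x.snd⟩⟩
instance : Sub Octonion := ⟨fun x y => ⟨x.fst - y.fst, x.snd - y.snd⟩⟩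
instance : SMul ℝ Octonion := ⟨fun r x => ⟨r • x.fst, r • x.snd⟩⟩
instance : One Octonion := ⟨⟨1, 0⟩⟩

/-- Cayley-Dickson product:
`(α + ℓ β) (γ + ℓ δ) = α γ - δ β^c + ℓ (α^c δ + γ β)`. -/
instance : Mul Octonion :=
  ⟨fun x y => ⟨x.fst * y.fst - y.snd * star x.snd, star x.fst * y.snd + y.fst * x.snd⟩⟩

/-- Conjugation: `(α + ℓ β)^c = α^c - ℓ β`. -/
instance : Star Octonion := ⟨fun x => ⟨star x.fst, -x.snd⟩⟩

@[simp] theorem fst_zero : (0 : Octonion).fst = 0 := rfl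
@[simp] theorem snd_zero : (0 : Octonion).snd = 0 := rfl
@[simp] theorem fst_one : (1 : Octonion).fst = 1 := rfl
@[simp] theorem snd_one : (1 : Octonion).snd = 0 := rfl
@[simp] theorem fst_add (x y : Octonion) : (x + y).fst = x.fst + y.fst := rfl
@[simp] theorem snd_add (x y : Octonion) : (x + y).snd = x.snd + y.snd := rfl
@[simp] theorem fst_neg (x : Octonion) : (-x).fst = -x.fst := rfl
@[simp] theorem snd_neg (x : Octonion) : (-x).snd = -x.snd := rfl
@[simp] theorem fst_sub (x y : Octonion) : (x - y).fst = x.fst - y.fst := rfl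
@[simp] theorem snd_sub (x y : Octonion) : (x - y).snd = x.snd - y.snd := rfl
@[simp] theorem fst_smul (r : ℝ) (x : Octonion) : (r • x).fst = r • x.fst := rfl
@[simp] theorem snd_smul (r : ℝ) (x : Octonion) : (r • x).snd = r • x.snd := rfl
@[simp] theorem fst_mul (x y : Octonion) :
    (x * y).fst = x.fst * y.fst - y.snd * star x.snd := rfl
@[simp] theorem snd_mul (x y : Octonion) :
    (x * y).snd = star x.fst * y.snd + y.fst * x.snd := rfl
@[simp] theorem fst_star (x : Octonion) : (star x).fst = star x.fst := rfl
@[simp] theorem snd_star (x : Octonion) : (star x).snd = -x.snd := rfl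

instance : AddCommGroup Octonion where
  add_assoc x y z := by ext1 <;> simp [add_assoc]
  zero_add x := by ext1 <;> simp
  add_zero x := by ext1 <;> simp
  add_comm x y := by ext1 <;> simp [add_comm]
  neg_add_cancel x := by ext1 <;> simp
  sub_eq_add_neg x y := by ext1 <;> simp [sub_eq_add_neg]
  nsmul := nsmulRec
  zsmul := zsmulRec

instance : NonAssocRing Octonion where
  left_distrib x y z := by ext1 <;> simp [mul_add, add_mul] <;> abel
  right_distrib x y z := by ext1 <;> simp [mul_add, add_mul] <;> abel
  zero_mul x := by ext1 <;> simp
  mul_zero x := by ext1 <;> simp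
  one_mul x := by ext1 <;> simp
  mul_one x := by ext1 <;> simp

instance : Module ℝ Octonion where
  one_smul x := by ext1 <;> simp
  mul_smul r s x := by ext1 <;> simp [mul_smul]
  smul_zero r := by ext1 <;> simp
  smul_add r x y := by ext1 <;> simp
  add_smul r s x := by ext1 <;> simp [add_smul]
  zero_smul x := by ext1 <;> simp

instance : IsScalarTower ℝ Octonion Octonion where
  smul_assoc r x y := by ext1 <;> simp [smul_sub, smul_add]

instance : SMulCommClass ℝ Octonion Octonion where
  smul_comm r x y := by ext1 <;> simp [smul_sub, smul_add]

instance : StarRing Octonion where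
  star_involutive x := by ext1 <;> simp
  star_mul x y := by ext1 <;> simp
  star_add x y := by ext1 <;> simp [add_comm]

instance : StarModule ℝ Octonion where
  star_smul r x := by ext1 <;> simp

instance : Nontrivial Octonion := ⟨0, 1, fun h => zero_ne_one (congrArg fst h)⟩

/-- The real number `n(x) = x x^c`. -/
def normSq (x : Octonion) : ℝ := Quaternion.normSq x.fst + Quaternion.normSq x.snd

theorem mul_star_self (x : Octonion) : x * star x = x.normSq • (1 : Octonion) := by
  ext1
  · simp [normSq, Quaternion.self_mul_star, add_smul, ← Algebra.algebraMap_eq_smul_one]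
  · simp

/-- The inverse `x⁻¹ = n(x)⁻¹ x^c` (with `0⁻¹ = 0`). -/
instance : Inv Octonion := ⟨fun x => x.normSq⁻¹ • star x⟩

theorem inv_def (x : Octonion) : x⁻¹ = x.normSq⁻¹ • star x := rfl

theorem mul_inv_cancel {x : Octonion} (hx : x ≠ 0) : x * x⁻¹ = 1 := by
  have h : x.normSq ≠ 0 := by
    intro h
    have h1 := Quaternion.normSq_nonneg (a := x.fst)
    have h2 := Quaternion.normSq_nonneg (a := x.snd)
    unfold normSq at h
    apply hx
    ext1
    · exact Quaternion.normSq_eq_zero.1 (by linarith)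
    · exact Quaternion.normSq_eq_zero.1 (by linarith)
  rw [inv_def, mul_smul_comm, mul_star_self, smul_smul, inv_mul_cancel₀ h, one_smul]

end Octonion

end

instance : StarModule ℝ ℍ[ℝ] where
  star_smul r x := by simp

/-! ## Imaginary units, circular sets

From here on, `A` is a (not necessarily associative) unital real `*`-algebra; the theorem uses
`A = ℂ, ℍ, 𝕆`. The real number `α` is identified with `α • 1`. -/

/-- The sphere of imaginary units `𝕊 = {x ∈ A | t(x) = 0, n(x) = 1}`, where `t(x) = x + x^c` and
`n(x) = x x^c`. -/
def imaginaryUnits (A : Type*) [NonAssocRing A] [StarRing A] : Set A :=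
  {x | x + star x = 0 ∧ x * star x = 1}

/-- The circularization `Ω_E` in `A` of a subset `E` of `ℂ`. -/
def circularization (A : Type*) [NonAssocRing A] [StarRing A] [Module ℝ A] (E : Set ℂ) : Set A :=
  {x | ∃ α β : ℝ, ∃ J ∈ imaginaryUnits A, x = α • 1 + β • J ∧ (⟨α, β⟩ : ℂ) ∈ E}

/-- A subset of `A` is circular if it is the circularization of a subset of `ℂ`. -/
def IsCircular {A : Type*} [NonAssocRing A] [StarRing A] [Module ℝ A] (Ω : Set A) : Prop :=
  ∃ E : Set ℂ, Ω = circularization A E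

/-! ## Stem functions -/

/-- A stem function `F = F₁ + ι F₂` with values in the complexification `A ⊗ ℂ = A + ι A` and with
`F(conj z) = conj (F z)`. A stem function on a conjugation-invariant set `D` is the
restriction to `D` of one on `ℂ` (extend by `0`). -/
@[ext]
structure StemFunction (A : Type*) [NonAssocRing A] where
  fst : ℂ → A
  snd : ℂ → A
  fst_conj : ∀ z, fst (conj z) = fst z
  snd_conj : ∀ z, snd (conj z) = -snd z

namespace StemFunction

variable {A : Type*} [NonAssocRing A]

/-- The constant `1`. -/
instance : One (StemFunction A) := ⟨⟨fun _ => 1, fun _ => 0, fun _ => rfl, fun _ => by simp⟩⟩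

/-- Pointwise multiplication in `A + ι A`, with `ι ^ 2 = -1` and `ι` central:
`(F₁ + ι F₂) (G₁ + ι G₂) = (F₁ G₁ - F₂ G₂) + ι (F₁ G₂ + F₂ G₁)`. -/
instance : Mul (StemFunction A) :=
  ⟨fun F G =>
    { fst := fun z => F.fst z * G.fst z - F.snd z * G.snd z
      snd := fun z => F.fst z * G.snd z + F.snd z * G.fst z
      fst_conj := fun z => by simp [F.fst_conj, F.snd_conj, G.fst_conj, G.snd_conj]
      snd_conj := fun z => by
        simp only [F.fst_conj, F.snd_conj, G.fst_conj, G.snd_conj, mul_neg, neg_mul]; abel }⟩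

/-- `F^c = F₁^c + ι F₂^c`. -/
instance [StarRing A] : Star (StemFunction A) :=
  ⟨fun F =>
    { fst := fun z => star (F.fst z)
      snd := fun z => star (F.snd z)
      fst_conj := fun z => by simp [F.fst_conj]
      snd_conj := fun z => by simp [F.snd_conj] }⟩

/-- `F` induces `f : Ω → A` if `f(α + β J) = F₁(α + i β) + J F₂(α + i β)` whenever `J ∈ 𝕊` and
`α + β J ∈ Ω`. -/
def Induces [StarRing A] [Module ℝ A] (F : StemFunction A) {Ω : Set A} (f : Ω → A) : Prop :=
  ∀ (α β : ℝ), ∀ J ∈ imaginaryUnits A, ∀ h : α • (1 : A) + β • J ∈ Ω,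
    f ⟨α • (1 : A) + β • J, h⟩ = F.fst ⟨α, β⟩ + J * F.snd ⟨α, β⟩

end StemFunction

section Induced

variable {A : Type*} [NonAssocRing A] [StarRing A] [Module ℝ A] [IsScalarTower ℝ A A]
  [SMulCommClass ℝ A A] [StarModule ℝ A] [Nontrivial A]

/-- The presentation `α + β J` is unique up to the sign of `(β, J)`, and up to `J` if `β = 0`. -/
theorem presentation_unique {α β α' β' : ℝ} {J J' : A}
    (hJ : J ∈ imaginaryUnits A) (hJ' : J' ∈ imaginaryUnits A)
    (h : α • (1 : A) + β • J = α' • (1 : A) + β' • J') :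
    α' = α ∧ ((β = 0 ∧ β' = 0) ∨ (β' = β ∧ J' = J) ∨ (β' = -β ∧ J' = -J)) := by
  have sJ : star J = -J := (neg_eq_of_add_eq_zero_right hJ.1).symm
  have sJ' : star J' = -J' := (neg_eq_of_add_eq_zero_right hJ'.1).symm
  have nJ : J * J = -1 := by have := hJ.2; rw [sJ, mul_neg] at this; rw [← this, neg_neg]
  have nJ' : J' * J' = -1 := by have := hJ'.2; rw [sJ', mul_neg] at this; rw [← this, neg_neg]
  have h' := congrArg star h
  simp only [star_add, star_smul, star_one, sJ, sJ', smul_neg, star_trivial] at h'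
  have h2 : (2 * α) • (1 : A) = (2 * α') • (1 : A) := by
    have := congrArg₂ (HAdd.hAdd (γ := A)) h h'
    rw [two_mul, two_mul, add_smul, add_smul]
    convert this using 1 <;> abel
  have hα : α = α' := by
    have := smul_left_injective ℝ (one_ne_zero (α := A)) h2
    linarith
  subst hα
  have h3 : β • J = β' • J' := add_left_cancel h
  have h4 : (β * β) • (1 : A) = (β' * β') • (1 : A) := by
    have := congrArg (fun x => -(x * x)) h3
    simpa [smul_mul_assoc, mul_smul_comm, nJ, nJ', smul_smul] using this
  have h5 : β * β = β' * β' := smul_left_injective ℝ (one_ne_zero (α := A)) h4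
  refine ⟨rfl, ?_⟩
  rcases eq_or_ne β 0 with h0 | h0
  · subst h0
    exact Or.inl ⟨rfl, by simpa using h5.symm⟩
  · right
    rcases mul_self_eq_mul_self_iff.1 h5 with h6 | h6
    · subst h6
      exact Or.inl ⟨rfl, (smul_right_injective A h0 h3).symm⟩
    · have h7 : β' = -β := by linarith
      subst h7
      refine Or.inr ⟨rfl, ?_⟩
      have h8 : J = -J' := by
        apply smul_right_injective A h0
        simpa using h3
      rw [h8, neg_neg]

/-- The expression `F₁(α + i β) + J F₂(α + i β)` only depends on `α + β J`. -/
theorem StemFunction.wellDefined (F : StemFunction A) {α β α' β' : ℝ} {J J' : A}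
    (hJ : J ∈ imaginaryUnits A) (hJ' : J' ∈ imaginaryUnits A)
    (h : α • (1 : A) + β • J = α' • (1 : A) + β' • J') :
    F.fst ⟨α, β⟩ + J * F.snd ⟨α, β⟩ = F.fst ⟨α', β'⟩ + J' * F.snd ⟨α', β'⟩ := by
  have key : ∀ (γ : ℝ), (F.fst ⟨α, -γ⟩ = F.fst ⟨α, γ⟩) ∧ (F.snd ⟨α, -γ⟩ = -F.snd ⟨α, γ⟩) :=
    fun γ => ⟨F.fst_conj ⟨α, γ⟩, F.snd_conj ⟨α, γ⟩⟩
  obtain ⟨rfl, ⟨rfl, rfl⟩ | ⟨rfl, rfl⟩ | ⟨rfl, rfl⟩⟩ := presentation_unique hJ hJ' h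
  · have hz : F.snd ⟨α', 0⟩ = 0 := by
      have := (key 0).2
      rw [neg_zero] at this
      have h6 : (2 : ℝ) • F.snd ⟨α', 0⟩ = 0 := by
        rw [two_smul]; nth_rw 1 [this]; exact neg_add_cancel _
      simpa using h6
    simp [hz]
  · rfl
  · rw [(key β).1, (key β).2, neg_mul_neg]

/-- A slice function `f : Ω → A`: a function induced by a stem function. (It is meant for
circular sets `Ω`.) -/
@[ext]
structure SliceFunction (Ω : Set A) where
  toFun : Ω → A
  exists_stem : ∃ F : StemFunction A, F.Induces toFun

namespace SliceFunction

variable {Ω : Set A}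

instance : CoeFun (SliceFunction Ω) (fun _ => Ω → A) := ⟨toFun⟩

open Classical in
/-- The slice function on `Ω` induced by a stem function. The values at points that have no
presentation `α + β J` with `J ∈ 𝕊` are set to `0`; such points do not exist in circular sets. -/
noncomputable def ofStem (F : StemFunction A) (Ω : Set A) : SliceFunction Ω where
  toFun x :=
    if h : ∃ p : ℝ × ℝ × A, p.2.2 ∈ imaginaryUnits A ∧ (x : A) = p.1 • (1 : A) + p.2.1 • p.2.2 then
      F.fst ⟨h.choose.1, h.choose.2.1⟩ + h.choose.2.2 * F.snd ⟨h.choose.1, h.choose.2.1⟩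
    else 0
  exists_stem := by
    refine ⟨F, fun α β J hJ hx => ?_⟩
    have h : ∃ p : ℝ × ℝ × A, p.2.2 ∈ imaginaryUnits A ∧
        α • (1 : A) + β • J = p.1 • (1 : A) + p.2.1 • p.2.2 := ⟨(α, β, J), hJ, rfl⟩
    refine Eq.trans (dif_pos h) ?_
    exact (F.wellDefined hJ h.choose_spec.1 h.choose_spec.2).symm

/-- A stem function that induces `f`. On a circular set `Ω = Ω_D` (with `D` conjugation-invariant)
its values on `D` are determined by `f`; see `stem_unique`. -/
noncomputable def stem (f : SliceFunction Ω) : StemFunction A := f.exists_stem.choose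

/-- Uniqueness of the stem function, when `J (J a) = -a` for `J ∈ 𝕊` (as in `ℂ`, `ℍ`, `𝕆`). -/
theorem stem_unique (hA : ∀ J ∈ imaginaryUnits A, ∀ a : A, J * (J * a) = -a) {E : Set ℂ}
    (hΩ : Ω = circularization A E) (f : SliceFunction Ω) {F : StemFunction A} (hF : F.Induces f)
    {α β : ℝ} {J : A} (hJ : J ∈ imaginaryUnits A) (hx : α • (1 : A) + β • J ∈ Ω) :
    f.stem.fst ⟨α, β⟩ = F.fst ⟨α, β⟩ ∧ f.stem.snd ⟨α, β⟩ = F.snd ⟨α, β⟩ := by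
  have sJ : star J = -J := (neg_eq_of_add_eq_zero_right hJ.1).symm
  have hJn : -J ∈ imaginaryUnits A := by
    refine ⟨?_, ?_⟩
    · rw [star_neg, sJ]; simp
    · rw [star_neg, neg_mul_neg]; exact hJ.2
  have hx' : α • (1 : A) + β • (-J) ∈ Ω := by
    subst hΩ
    obtain ⟨α', β', J', hJ', h, hE⟩ := hx
    obtain ⟨rfl, ⟨rfl, rfl⟩ | ⟨rfl, rfl⟩ | ⟨rfl, rfl⟩⟩ := presentation_unique hJ hJ' h
    · exact ⟨_, 0, J, hJ, by simp, hE⟩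
    · exact ⟨_, _, _, hJn, rfl, hE⟩
    · exact ⟨_, _, J, hJ, by simp, hE⟩
  have hG := f.exists_stem.choose_spec
  have e1 := (hG α β J hJ hx).symm.trans (hF α β J hJ hx)
  have e2 := (hG α β (-J) hJn hx').symm.trans (hF α β (-J) hJn hx')
  change f.stem.fst _ + J * f.stem.snd _ = _ at e1
  change f.stem.fst _ + -J * f.stem.snd _ = _ at e2
  generalize f.stem.fst ⟨α, β⟩ = a at *
  generalize f.stem.snd ⟨α, β⟩ = b at *
  generalize F.fst ⟨α, β⟩ = c at *
  generalize F.snd ⟨α, β⟩ = d at *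
  have h2 : (2 : ℝ) • a = (2 : ℝ) • c := by
    have := congrArg₂ (HAdd.hAdd (γ := A)) e1 e2
    simp only [neg_mul] at this
    rw [two_smul, two_smul]
    convert this using 1 <;> abel
  have hac : a = c := smul_right_injective A (two_ne_zero (α := ℝ)) h2
  subst hac
  refine ⟨rfl, ?_⟩
  have := congrArg (J * ·) (add_left_cancel e1)
  simpa [hA J hJ] using this

/-- The constant `1`. -/
noncomputable instance : One (SliceFunction Ω) := ⟨ofStem 1 Ω⟩

/-- The slice product `f · g`, induced by the product of the stem functions. -/
noncomputable instance : Mul (SliceFunction Ω) := ⟨fun f g => ofStem (f.stem * g.stem) Ω⟩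

/-- The slice conjugate `f^c`, induced by the conjugate of the stem function. -/
noncomputable instance : Star (SliceFunction Ω) := ⟨fun f => ofStem (star f.stem) Ω⟩

/-- The normal function `N(f) = f · f^c`. -/
noncomputable def normal (f : SliceFunction Ω) : SliceFunction Ω := f * star f

/-- The zero set `V(f) ⊆ Ω ⊆ A`. -/
def zeros (f : SliceFunction Ω) : Set A := {x | ∃ h : x ∈ Ω, f ⟨x, h⟩ = 0}

/-- The restriction of `f` to a subset `Ω'` of `Ω`. -/
def restrict (f : SliceFunction Ω) {Ω' : Set A} (h : Ω' ⊆ Ω) : SliceFunction Ω' where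
  toFun x := f ⟨x, h x.2⟩
  exists_stem := f.exists_stem.imp fun _ hF α β J hJ hx => hF α β J hJ (h hx)

/-- The set `Ω' = Ω \ V(N(f))`. -/
def regularSet (f : SliceFunction Ω) : Set A := Ω \ f.normal.zeros

/-- `g` is the reciprocal `f^{-•}` of `f`: a multiplicative inverse of the restriction of `f` to
`Ω' = Ω \ V(N(f))` among the slice functions on `Ω'`. -/
def IsReciprocal (f : SliceFunction Ω) (g : SliceFunction f.regularSet) : Prop :=
  f.restrict Set.sdiff_subset * g = 1 ∧ g * f.restrict Set.sdiff_subset = 1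

end SliceFunction

end Induced

set_option linter.unusedSectionVars false

/-! Everything happens pointwise in `A + ιA`. Put a = |p|² - |q|² and b = 2 re(p q^c). The normal of
p + ιq is then a + ιb with real, hence central, coefficients, so wherever it is nonzero the inverse
is (a + ιb)⁻¹(p^c + ιq^c) (`inverse_formula`). Uniqueness follows by multiplying on the left by p^c
+ ιq^c (`normal_mul_eq_star`, `right_inverse_unique`). In place of associativity only the
alternative law x^c(xy) = |x|² y, its polarization and the associative trace `re` are needed.

For the image, fix z and let p + ιq be the stem value there. The set {Jq : J ∈ 𝕊} consists of the v
with |v| = |q| and v ⟂ q (`exists_imaginaryUnit_mul_eq`), so w is a value p + Jq exactly when |w|² -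
2 re(w p^c) + a = 0 and 2 re(w q^c) = b. For w = g⁻¹ = g^c/|g|² these become a|g|² + 1 = 2 re(pg)
and b|g|² = 2 re(qg), and both hold when g = r + Ks is a value of the inverse stem r + ιs
(`exists_mul_eq_one`). So inversion carries values of the reciprocal on a sphere to values of f on
the same sphere, in general at another point. Exchanging f and its reciprocal gives the other
inclusion. -/

/-! ## Real composition `*`-algebras -/

/-- The properties of the unital real `*`-algebras `ℂ`, `ℍ`, `𝕆` used below: there is a real-part
functional `re` which is a unital associative trace, and the norm `re (x * star x)` is definite
and satisfies the alternative law. -/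
class CompositionStarAlgebra (A : Type*) [NonAssocRing A] [StarRing A] [Module ℝ A] [Inv A] where
  re : A →ₗ[ℝ] ℝ
  re_one : re 1 = 1
  self_add_star : ∀ x : A, x + star x = (2 * re x) • (1 : A)
  star_mul_mul : ∀ x y : A, star x * (x * y) = re (x * star x) • y
  re_mul_comm : ∀ x y : A, re (x * y) = re (y * x)
  re_mul_assoc : ∀ x y z : A, re (x * y * z) = re (x * (y * z))
  eq_zero_of_norm : ∀ x : A, re (x * star x) = 0 → x = 0
  inv_eq : ∀ x : A, x⁻¹ = (re (x * star x))⁻¹ • star x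

namespace CompositionStarAlgebra

/-! ### Norm and trace identities, and inversion in `A + ιA` -/

section Pointwise

variable {A : Type*} [NonAssocRing A] [StarRing A] [Module ℝ A] [IsScalarTower ℝ A A]
  [SMulCommClass ℝ A A] [StarModule ℝ A] [Inv A] [CompositionStarAlgebra A]

/-- The norm form `x ↦ re (x x^c)`. -/
noncomputable def nrm (x : A) : ℝ := re (x * star x)

theorem re_star (x : A) : re (star x) = re x := by
  have h := congrArg re (self_add_star x)
  rw [map_add, map_smul, re_one, smul_eq_mul] at h
  linarith

theorem re_star_mul_self (x : A) : re (star x * x) = nrm x := re_mul_comm _ _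

theorem star_mul_self_eq (x : A) : star x * x = nrm x • (1 : A) := by
  simpa [nrm] using star_mul_mul x 1

theorem nrm_star (x : A) : nrm (star x) = nrm x := by
  rw [nrm, star_star, re_star_mul_self]

theorem self_mul_star_eq (x : A) : x * star x = nrm x • (1 : A) := by
  simpa [nrm_star] using star_mul_self_eq (star x)

theorem mul_mul_star (x y : A) : x * y * star y = nrm y • x := by
  have h := congrArg star (star_mul_mul (star y) (star x))
  rw [← nrm, nrm_star] at h
  simpa using h

/-- The associative trace turns re((y^c x^c)(xy)) into re(y^c (x^c (xy))), where the alternative law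
extracts |x|². -/
theorem nrm_mul (x y : A) : nrm (x * y) = nrm x * nrm y := by
  rw [nrm, re_mul_comm, star_mul, re_mul_assoc, star_mul_mul, mul_smul_comm, map_smul,
    smul_eq_mul, re_star_mul_self]
  rfl

theorem re_mul_star_comm (x y : A) : re (y * star x) = re (x * star y) := by
  rw [← re_star, star_mul, star_star]

theorem nrm_smul (c : ℝ) (x : A) : nrm (c • x) = c * c * nrm x := by
  simp [nrm, smul_mul_assoc, mul_smul_comm, mul_assoc]

theorem nrm_add (x y : A) : nrm (x + y) = nrm x + nrm y + 2 * re (x * star y) := by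
  have := re_mul_star_comm x y
  simp only [nrm, star_add, mul_add, add_mul, map_add]
  linarith

theorem nrm_sub (x y : A) : nrm (x - y) = nrm x + nrm y - 2 * re (x * star y) := by
  have := re_mul_star_comm x y
  simp only [nrm, star_sub, mul_sub, sub_mul, map_sub]
  linarith

theorem mul_star_add_mul_star (x y : A) :
    x * star y + y * star x = (2 * re (x * star y)) • (1 : A) := by
  simpa using self_add_star (x * star y)

theorem star_mul_add_star_mul (x y : A) :
    star x * y + star y * x = (2 * re (x * star y)) • (1 : A) := by
  have h := self_add_star (star x * y)
  rwa [star_mul, star_star, re_mul_comm, re_mul_star_comm] at h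

/-- Polarization of `star_mul_mul` in its first variable. -/
theorem star_mul_mul_add (x y z : A) :
    star x * (y * z) + star y * (x * z) = (2 * re (x * star y)) • z := by
  have h := star_mul_mul (x + y) z
  rw [← nrm, nrm_add, star_add, add_mul, add_mul, mul_add, mul_add, star_mul_mul x,
    star_mul_mul y, add_smul, add_smul, ← nrm, ← nrm] at h
  linear_combination (norm := module) h

/-- Left multiplication by x^c gives x^c = |x|² y, by the alternative law. -/
theorem mul_eq_one_inv {x y : A} (h : x * y = 1) : y = x⁻¹ := by
  have h1 := star_mul_mul x y
  rw [h, mul_one] at h1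
  have hx : re (x * star x) ≠ 0 := by
    intro h0
    have h2 : x = 0 := eq_zero_of_norm x h0
    rw [h2, zero_mul] at h
    have := congrArg re h
    rw [map_zero, re_one] at this
    exact zero_ne_one this
  rw [inv_eq]
  nth_rw 2 [h1]
  rw [smul_smul, inv_mul_cancel₀ hx, one_smul]

theorem mul_eq_one_symm {x y : A} (h : x * y = 1) : y * x = 1 := by
  rw [mul_eq_one_inv h, inv_eq, smul_mul_assoc, star_mul_self_eq, smul_smul, ← nrm,
    inv_mul_cancel₀, one_smul]
  intro h0
  have hx : x = 0 := eq_zero_of_norm x h0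
  rw [hx, zero_mul] at h
  have := congrArg re h
  rw [map_zero, re_one] at this
  exact zero_ne_one this

theorem re_imaginaryUnit {J : A} (hJ : J ∈ imaginaryUnits A) : re J = 0 := by
  have h := congrArg re hJ.1
  rw [map_add, re_star, map_zero] at h
  linarith

theorem nrm_imaginaryUnit {J : A} (hJ : J ∈ imaginaryUnits A) : nrm J = 1 := by
  rw [nrm, hJ.2, re_one]

/-- The alternative law with J^c = -J and |J| = 1. It supplies the hypothesis of `stem_unique`. -/
theorem imaginaryUnit_mul_mul (J : A) (hJ : J ∈ imaginaryUnits A) (a : A) :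
    J * (J * a) = -a := by
  have h := star_mul_mul J a
  rw [hJ.2, re_one, one_smul, (neg_eq_of_add_eq_zero_right hJ.1).symm, neg_mul] at h
  exact neg_eq_iff_eq_neg.1 h

/-- The sphere `{J q : J ∈ 𝕊}` consists of the elements of the norm of `q` orthogonal to `q`. -/
theorem exists_imaginaryUnit_mul_eq {K q v : A} (hK : K ∈ imaginaryUnits A)
    (hn : nrm v = nrm q) (ho : re (v * star q) = 0) : ∃ J ∈ imaginaryUnits A, J * q = v := by
  by_cases h0 : nrm q = 0
  · have hq : q = 0 := eq_zero_of_norm q h0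
    have hv : v = 0 := eq_zero_of_norm v (hn.trans h0)
    -- For q = 0 any unit works; K only witnesses that 𝕊 is nonempty.
    exact ⟨K, hK, by rw [hq, hv, mul_zero]⟩
  -- J = v q⁻¹: orthogonality makes its trace vanish, multiplicativity of the norm makes it a unit,
  -- and `mul_mul_star` gives Jq = v.
  · refine ⟨(nrm q)⁻¹ • (v * star q), ⟨?_, ?_⟩, ?_⟩
    · rw [self_add_star, map_smul, ho, smul_zero, mul_zero, zero_smul]
    · rw [self_mul_star_eq, nrm_smul, nrm_mul, nrm_star, hn]
      field_simp
      exact one_smul _ _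
    · have h := mul_mul_star v (star q)
      rw [star_star, nrm_star] at h
      rw [smul_mul_assoc, h, smul_smul, inv_mul_cancel₀ h0, one_smul]

/-- Multiplying `(p + ι q) (r + ι s) = 1` on the left by `(p + ι q)^c`. -/
theorem normal_mul_eq_star {p q r s : A} (h1 : p * r - q * s = 1) (h2 : p * s + q * r = 0) :
    (nrm p - nrm q) • r - (2 * re (p * star q)) • s = star p ∧
    (nrm p - nrm q) • s + (2 * re (p * star q)) • r = star q := by
  have e1 := star_mul_mul_add p q s
  have e2 := star_mul_mul_add p q r
  have a1 := star_mul_mul p r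
  have a2 := star_mul_mul q s
  have a3 := star_mul_mul p s
  have a4 := star_mul_mul q r
  rw [← nrm] at a1 a2 a3 a4
  have c1 : star p * (p * r - q * s) - star q * (p * s + q * r) = star p := by
    rw [h1, h2, mul_one, mul_zero, sub_zero]
  have c2 : star p * (p * s + q * r) + star q * (p * r - q * s) = star q := by
    rw [h1, h2, mul_one, mul_zero, zero_add]
  rw [← e1, ← e2, sub_smul, sub_smul, ← a1, ← a2, ← a3, ← a4]
  rw [mul_sub, mul_add] at c1 c2
  constructor
  · exact Eq.trans (by abel) c1
  · exact Eq.trans (by abel) c2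

/-- The real linear system has determinant a² + b², which is nonzero. -/
theorem eq_of_normal_mul_eq {a b : ℝ} (hab : ¬(a = 0 ∧ b = 0)) {r s r' s' : A}
    (h1 : a • r - b • s = a • r' - b • s') (h2 : a • s + b • r = a • s' + b • r') :
    r = r' ∧ s = s' := by
  have hN : a * a + b * b ≠ 0 := fun h =>
    hab ⟨by nlinarith [mul_self_nonneg a, mul_self_nonneg b],
      by nlinarith [mul_self_nonneg a, mul_self_nonneg b]⟩
  constructor
  · have : (a * a + b * b) • r = (a * a + b * b) • r' := by
      linear_combination (norm := module) a • h1 + b • h2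
    simpa [hN] using congrArg ((a * a + b * b)⁻¹ • ·) this
  · have : (a * a + b * b) • s = (a * a + b * b) • s' := by
      linear_combination (norm := module) a • h2 - b • h1
    simpa [hN] using congrArg ((a * a + b * b)⁻¹ • ·) this

/-- Right inverses in `A + ι A` are unique. -/
theorem right_inverse_unique [Nontrivial A] {p q r s r' s' : A} (h1 : p * r - q * s = 1)
    (h2 : p * s + q * r = 0) (h1' : p * r' - q * s' = 1) (h2' : p * s' + q * r' = 0) :
    r = r' ∧ s = s' := by
  have e := normal_mul_eq_star h1 h2
  have e' := normal_mul_eq_star h1' h2'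
  refine eq_of_normal_mul_eq (a := nrm p - nrm q) (b := 2 * re (p * star q)) ?_
    (e.1.trans e'.1.symm) (e.2.trans e'.2.symm)
  -- If the normal vanished, p^c and q^c would be 0, contradicting pr - qs = 1.
  rintro ⟨ha, hb⟩
  rw [ha, hb] at e
  simp only [zero_smul, sub_zero, add_zero] at e
  have hp : p = 0 := star_eq_zero.1 e.1.symm
  have hq : q = 0 := star_eq_zero.1 e.2.symm
  rw [hp, hq, zero_mul, zero_mul, sub_zero] at h1
  exact zero_ne_one h1

/-- If `(p + ι q) (r + ι s) = 1`, every `r + K s` is the inverse of some `p + J q`. -/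
theorem exists_mul_eq_one {p q r s : A} (h1 : p * r - q * s = 1) (h2 : p * s + q * r = 0)
    {K : A} (hK : K ∈ imaginaryUnits A) :
    ∃ J ∈ imaginaryUnits A, (p + J * q) * (r + K * s) = 1 := by
  obtain ⟨e1, e2⟩ := normal_mul_eq_star h1 h2
  set a := nrm p - nrm q with ha
  set b := 2 * re (p * star q) with hb
  -- Conjugating `normal_mul_eq_star` expresses p and q through r and s.
  have hp : p = a • star r - b • star s := by
    simpa using (congrArg star e1).symm
  have hq : q = a • star s + b • star r := by
    simpa using (congrArg star e2).symm
  have hsr : re (star s * r) = re (star r * s) := by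
    rw [← re_star, star_mul, star_star]
  have hsKs : re (star s * (K * s)) = 0 := by
    rw [re_mul_comm, re_mul_assoc, self_mul_star_eq, mul_smul_comm, mul_one, map_smul,
      re_imaginaryUnit hK, smul_zero]
  -- The next two equations say that the normal of r + ιs is the inverse of a + ιb.
  have hnu1 : a * (nrm r - nrm s) - b * (2 * re (star r * s)) = 1 := by
    have h := congrArg re h1
    rw [hp, hq, re_one] at h
    simp only [sub_mul, add_mul, smul_mul_assoc, map_sub, map_add, map_smul, smul_eq_mul,
      re_star_mul_self, hsr] at h
    linarith
  have hnu2 : a * (2 * re (star r * s)) + b * (nrm r - nrm s) = 0 := by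
    have h := congrArg re h2
    rw [hp, hq, map_zero] at h
    simp only [sub_mul, add_mul, smul_mul_assoc, map_sub, map_add, map_smul, smul_eq_mul,
      re_star_mul_self, hsr] at h
    linarith
  set g := r + K * s with hg
  have hng : nrm g = nrm r + nrm s + 2 * re (star r * (K * s)) := by
    rw [hg, nrm_add, nrm_mul, nrm_imaginaryUnit hK, one_mul, ← re_mul_star_comm,
      re_mul_comm (star r)]
  -- `hI` and `hII` are the two conditions for g⁻¹ to have the form p + Jq, with denominators
  -- cleared.
  have hI : a * nrm g + 1 = 2 * re (p * g) := by
    rw [hng, hp, hg]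
    simp only [sub_mul, mul_add, smul_mul_assoc, map_sub, map_add, map_smul, smul_eq_mul,
      re_star_mul_self, hsr, hsKs]
    linarith
  have hII : b * nrm g = 2 * re (q * g) := by
    rw [hng, hq, hg]
    simp only [add_mul, mul_add, smul_mul_assoc, map_add, map_smul, smul_eq_mul,
      re_star_mul_self, hsr, hsKs]
    linarith
  have hg0 : nrm g ≠ 0 := by
    intro h
    have hz : g = 0 := eq_zero_of_norm g h
    rw [h, hz, mul_zero p, map_zero] at hI
    norm_num at hI
  have hgp : ∀ x : A, re (star g * star x) = re (x * g) := fun x => by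
    rw [← star_mul, re_star]
  -- Here v = g⁻¹ - p is the element to be written as Jq.
  have hn : nrm ((nrm g)⁻¹ • star g - p) = nrm q := by
    rw [nrm_sub, nrm_smul, nrm_star, smul_mul_assoc, map_smul, hgp, smul_eq_mul]
    field_simp
    linear_combination hI + nrm g * ha
  have ho : re (((nrm g)⁻¹ • star g - p) * star q) = 0 := by
    rw [sub_mul, map_sub, smul_mul_assoc, map_smul, hgp, smul_eq_mul]
    field_simp
    linarith
  obtain ⟨J, hJ, hJq⟩ := exists_imaginaryUnit_mul_eq hK hn ho
  refine ⟨J, hJ, ?_⟩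
  rw [hJq, add_sub_cancel, smul_mul_assoc, star_mul_self_eq, smul_smul, inv_mul_cancel₀ hg0,
    one_smul]

/-- An element `p + ι q` of `A + ι A` with invertible norm is invertible. -/
theorem inverse_formula {p q : A} {a b : ℝ} (ha : a = nrm p - nrm q)
    (hb : b = 2 * re (p * star q)) (hab : ¬(a = 0 ∧ b = 0)) {r s : A}
    (hr : r = (a * a + b * b)⁻¹ • (a • star p + b • star q))
    (hs : s = (a * a + b * b)⁻¹ • (a • star q - b • star p)) :
    (p * r - q * s = 1 ∧ p * s + q * r = 0) ∧ (r * p - s * q = 1 ∧ r * q + s * p = 0) := by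
  have hN : a * a + b * b ≠ 0 := fun h =>
    hab ⟨by nlinarith [mul_self_nonneg a, mul_self_nonneg b],
      by nlinarith [mul_self_nonneg a, mul_self_nonneg b]⟩
  have l1 := mul_star_add_mul_star p q
  have l2 := star_mul_add_star_mul p q
  rw [← hb] at l1 l2
  have hq : nrm p = a + nrm q := by linarith
  have p1 := self_mul_star_eq p
  have p2 := star_mul_self_eq p
  have q1 := self_mul_star_eq q
  have q2 := star_mul_self_eq q
  rw [hq] at p1 p2
  -- Since a and b are real, each of the four components reduces to the difference of the norms (a)
  -- and the polarized norm (b), with no associator appearing.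
  have e1 : (a * a + b * b) • (1 : A) = a • (p * star p) + b • (p * star q)
      - (a • (q * star q) - b • (q * star p)) := by
    linear_combination (norm := module) -(a • p1) + a • q1 - b • l1
  have e2 : (0 : A) = a • (p * star q) - b • (p * star p)
      + (a • (q * star p) + b • (q * star q)) := by
    linear_combination (norm := module) b • p1 - b • q1 - a • l1
  have e3 : (a * a + b * b) • (1 : A) = a • (star p * p) + b • (star q * p)
      - (a • (star q * q) - b • (star p * q)) := by
    linear_combination (norm := module) -(a • p2) + a • q2 - b • l2
  have e4 : (0 : A) = a • (star p * q) + b • (star q * q)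
      + (a • (star q * p) - b • (star p * p)) := by
    linear_combination (norm := module) b • p2 - b • q2 - a • l2
  subst hr hs
  simp only [smul_mul_assoc, mul_smul_comm, mul_add, mul_sub, add_mul, sub_mul]
  simp only [← smul_sub, ← smul_add, ← mul_smul_comm]
  simp only [mul_smul_comm]
  rw [← e1, ← e2, ← e3, ← e4, smul_zero, smul_smul, inv_mul_cancel₀ hN, one_smul]
  exact ⟨⟨rfl, rfl⟩, rfl, rfl⟩

end Pointwise

end CompositionStarAlgebra

/-! ## Reciprocals of slice functions -/

section Reciprocal

open CompositionStarAlgebra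

variable {A : Type*} [NonAssocRing A] [StarRing A] [Module ℝ A] [IsScalarTower ℝ A A]
  [SMulCommClass ℝ A A] [StarModule ℝ A] [Nontrivial A]

namespace SliceFunction

theorem ofStem_induces (F : StemFunction A) (Ω : Set A) : F.Induces (ofStem F Ω) := by
  intro α β J hJ hx
  have h : ∃ p : ℝ × ℝ × A, p.2.2 ∈ imaginaryUnits A ∧
      α • (1 : A) + β • J = p.1 • (1 : A) + p.2.1 • p.2.2 := ⟨(α, β, J), hJ, rfl⟩
  refine Eq.trans (dif_pos h) ?_
  exact (F.wellDefined hJ h.choose_spec.1 h.choose_spec.2).symm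

theorem stem_induces {Ω : Set A} (f : SliceFunction Ω) : f.stem.Induces f :=
  f.exists_stem.choose_spec

/-- Two slice functions on a circular set agree if stem functions inducing them do. -/
theorem ext_of_stem {E : Set ℂ} {Ω : Set A} (hΩ : Ω = circularization A E) {f g : SliceFunction Ω}
    {F G : StemFunction A} (hF : F.Induces f) (hG : G.Induces g)
    (h : ∀ (α β : ℝ), ∀ J ∈ imaginaryUnits A, α • (1 : A) + β • J ∈ Ω →
      F.fst ⟨α, β⟩ = G.fst ⟨α, β⟩ ∧ F.snd ⟨α, β⟩ = G.snd ⟨α, β⟩) : f = g := by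
  ext x
  obtain ⟨x, hx⟩ := x
  obtain ⟨α, β, J, hJ, rfl, -⟩ : x ∈ circularization A E := hΩ ▸ hx
  rw [hF α β J hJ hx, hG α β J hJ hx, (h α β J hJ hx).1, (h α β J hJ hx).2]

variable [Inv A] [CompositionStarAlgebra A] {E : Set ℂ} {Ω : Set A}

/-- The product is defined through chosen stems; by uniqueness any inducing stems may replace them.
-/
theorem mul_induces (hΩ : Ω = circularization A E) {f g : SliceFunction Ω} {F G : StemFunction A}
    (hF : F.Induces f) (hG : G.Induces g) : (F * G).Induces (f * g : SliceFunction Ω) := by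
  intro α β J hJ hx
  have h1 := stem_unique imaginaryUnit_mul_mul hΩ f hF hJ hx
  have h2 := stem_unique imaginaryUnit_mul_mul hΩ g hG hJ hx
  refine (ofStem_induces (f.stem * g.stem) Ω α β J hJ hx).trans ?_
  change (f.stem.fst _ * g.stem.fst _ - f.stem.snd _ * g.stem.snd _) +
    J * (f.stem.fst _ * g.stem.snd _ + f.stem.snd _ * g.stem.fst _) = _
  rw [h1.1, h1.2, h2.1, h2.2]
  rfl

/-- The real part of the normal function, as a function of `z`. -/
noncomputable def normalRe (f : SliceFunction Ω) (z : ℂ) : ℝ :=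
  nrm (f.stem.fst z) - nrm (f.stem.snd z)

/-- The `ι`-part of the normal function, as a function of `z`. -/
noncomputable def normalIm (f : SliceFunction Ω) (z : ℂ) : ℝ :=
  2 * re (f.stem.fst z * star (f.stem.snd z))

theorem normal_apply (hΩ : Ω = circularization A E) (f : SliceFunction Ω) {α β : ℝ} {J : A}
    (hJ : J ∈ imaginaryUnits A) (hx : α • (1 : A) + β • J ∈ Ω) :
    f.normal ⟨_, hx⟩ = f.normalRe ⟨α, β⟩ • (1 : A) + f.normalIm ⟨α, β⟩ • J := by
  refine (mul_induces hΩ (f := f) (g := star f) f.stem_induces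
    (ofStem_induces (star f.stem) Ω) α β J hJ hx).trans ?_
  change (f.stem.fst _ * star (f.stem.fst _) - f.stem.snd _ * star (f.stem.snd _)) +
    J * (f.stem.fst _ * star (f.stem.snd _) + f.stem.snd _ * star (f.stem.fst _)) = _
  rw [mul_star_add_mul_star, self_mul_star_eq, self_mul_star_eq, mul_smul_comm, mul_one,
    ← sub_smul]
  rfl

/-- 1 and J are linearly independent, by `presentation_unique`. The criterion does not involve J,
which is why V(N(f)) is a union of spheres and its complement in Ω is circular. -/
theorem normal_apply_ne_zero_iff (hΩ : Ω = circularization A E) (f : SliceFunction Ω) {α β : ℝ}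
    {J : A} (hJ : J ∈ imaginaryUnits A) (hx : α • (1 : A) + β • J ∈ Ω) :
    f.normal ⟨_, hx⟩ ≠ 0 ↔ ¬(f.normalRe ⟨α, β⟩ = 0 ∧ f.normalIm ⟨α, β⟩ = 0) := by
  rw [normal_apply hΩ f hJ hx, not_iff_not]
  constructor
  · intro h
    have h' : (0 : ℝ) • (1 : A) + (0 : ℝ) • J =
        f.normalRe ⟨α, β⟩ • (1 : A) + f.normalIm ⟨α, β⟩ • J := by rw [h]; simp
    obtain ⟨h1, h2⟩ := presentation_unique hJ hJ h'
    refine ⟨h1, ?_⟩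
    rcases h2 with h2 | h2 | h2
    · exact h2.2
    · exact h2.1
    · simpa using h2.1
  · rintro ⟨h1, h2⟩
    rw [h1, h2, zero_smul, zero_smul, add_zero]

theorem regularSet_eq (hΩ : Ω = circularization A E) (f : SliceFunction Ω) :
    f.regularSet =
      circularization A {z | z ∈ E ∧ ¬(f.normalRe z = 0 ∧ f.normalIm z = 0)} := by
  ext x
  constructor
  · rintro ⟨hx, hn⟩
    obtain ⟨α, β, J, hJ, rfl, hE⟩ : x ∈ circularization A E := hΩ ▸ hx
    exact ⟨α, β, J, hJ, rfl, hE,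
      (normal_apply_ne_zero_iff hΩ f hJ hx).1 fun h => hn ⟨hx, h⟩⟩
  · rintro ⟨α, β, J, hJ, rfl, hE, hab⟩
    have hx : α • (1 : A) + β • J ∈ Ω := hΩ ▸ ⟨α, β, J, hJ, rfl, hE⟩
    exact ⟨hx, fun ⟨_, h⟩ => (normal_apply_ne_zero_iff hΩ f hJ hx).2 hab h⟩

/-- The stem function `N(F)⁻¹ F^c`. -/
noncomputable def reciprocalStem (f : SliceFunction Ω) : StemFunction A where
  -- (a + ιb)⁻¹ = (a - ιb)/(a² + b²). Where a = b = 0 the convention 0⁻¹ = 0 makes the value 0; such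
  -- points lie outside `regularSet`.
  fst z := (f.normalRe z * f.normalRe z + f.normalIm z * f.normalIm z)⁻¹ •
    (f.normalRe z • star (f.stem.fst z) + f.normalIm z • star (f.stem.snd z))
  snd z := (f.normalRe z * f.normalRe z + f.normalIm z * f.normalIm z)⁻¹ •
    (f.normalRe z • star (f.stem.snd z) - f.normalIm z • star (f.stem.fst z))
  fst_conj z := by
    simp [normalRe, normalIm, f.stem.fst_conj, f.stem.snd_conj, nrm]
  snd_conj z := by
    simp only [normalRe, normalIm, f.stem.fst_conj, f.stem.snd_conj, nrm, star_neg,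
      mul_neg, map_neg, neg_mul, neg_neg, smul_neg, neg_smul]
    module

theorem one_induces (Ω : Set A) : (1 : StemFunction A).Induces (1 : SliceFunction Ω) :=
  ofStem_induces 1 Ω

/-- A product of slice functions on a circular set is `1` iff the product of the stem functions
is. -/
theorem mul_eq_one_iff (hΩ : Ω = circularization A E) {f g : SliceFunction Ω}
    {F G : StemFunction A} (hF : F.Induces f) (hG : G.Induces g) :
    f * g = 1 ↔ ∀ (α β : ℝ), ∀ J ∈ imaginaryUnits A, α • (1 : A) + β • J ∈ Ω →
      F.fst ⟨α, β⟩ * G.fst ⟨α, β⟩ - F.snd ⟨α, β⟩ * G.snd ⟨α, β⟩ = 1 ∧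
      F.fst ⟨α, β⟩ * G.snd ⟨α, β⟩ + F.snd ⟨α, β⟩ * G.fst ⟨α, β⟩ = 0 := by
  constructor
  · intro h α β J hJ hx
    have h1 := stem_unique imaginaryUnit_mul_mul hΩ (f * g) (mul_induces hΩ hF hG) hJ hx
    have h2 := stem_unique imaginaryUnit_mul_mul hΩ (f * g) (h ▸ one_induces Ω) hJ hx
    exact ⟨h1.1.symm.trans h2.1, h1.2.symm.trans h2.2⟩
  · intro h
    exact ext_of_stem hΩ (mul_induces hΩ hF hG) (one_induces Ω) h

theorem restrict_induces (f : SliceFunction Ω) {Ω' : Set A} (h : Ω' ⊆ Ω) :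
    f.stem.Induces (f.restrict h) :=
  fun α β J hJ hx => f.stem_induces α β J hJ (h hx)

/-- `regularSet` is circular, so being a reciprocal is a pointwise condition on stems, settled by
`inverse_formula` and `right_inverse_unique`. -/
theorem existsUnique_isReciprocal (hΩ : IsCircular Ω) (f : SliceFunction Ω) :
    ∃! g, f.IsReciprocal g := by
  obtain ⟨E, hΩ⟩ := hΩ
  have hΩ' := regularSet_eq hΩ f
  have hF := f.restrict_induces (Ω' := f.regularSet) Set.sdiff_subset
  have hG := ofStem_induces f.reciprocalStem f.regularSet
  have key : ∀ (α β : ℝ), ∀ J ∈ imaginaryUnits A, α • (1 : A) + β • J ∈ f.regularSet → _ :=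
    fun α β J hJ hx => inverse_formula (p := f.stem.fst ⟨α, β⟩) (q := f.stem.snd ⟨α, β⟩) rfl rfl
      ((normal_apply_ne_zero_iff hΩ f hJ hx.1).1 fun h => hx.2 ⟨hx.1, h⟩) rfl rfl
  refine ⟨ofStem f.reciprocalStem f.regularSet,
    ⟨(mul_eq_one_iff hΩ' hF hG).2 fun α β J hJ hx => (key α β J hJ hx).1,
      (mul_eq_one_iff hΩ' hG hF).2 fun α β J hJ hx => (key α β J hJ hx).2⟩, fun g hg => ?_⟩
  have h1 := (mul_eq_one_iff hΩ' hF g.stem_induces).1 hg.1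
  refine ext_of_stem hΩ' g.stem_induces hG fun α β J hJ hx => ?_
  exact right_inverse_unique (h1 α β J hJ hx).1 (h1 α β J hJ hx).2
    (key α β J hJ hx).1.1 (key α β J hJ hx).1.2

/-- On a circular set the values of the reciprocal are the inverses of the values. -/
theorem isReciprocal_image (hΩ : IsCircular Ω) (f : SliceFunction Ω)
    (g : SliceFunction f.regularSet) (hg : f.IsReciprocal g) (C : Set A) (hC : IsCircular C)
    (hCΩ : C ⊆ f.regularSet) :
    (∀ x : Ω, (x : A) ∈ C → f x ≠ 0) ∧
      g '' {x | (x : A) ∈ C} = (fun x => (f x)⁻¹) '' {x : Ω | (x : A) ∈ C} := by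
  obtain ⟨E, hΩ⟩ := hΩ
  obtain ⟨E', hC⟩ := hC
  have hΩ' := regularSet_eq hΩ f
  have hF := f.restrict_induces (Ω' := f.regularSet) Set.sdiff_subset
  have h1 := (mul_eq_one_iff hΩ' hF g.stem_induces).1 hg.1
  have h2 := (mul_eq_one_iff hΩ' g.stem_induces hF).1 hg.2
  -- Circularity of C: the point may move along its sphere without leaving C.
  have hmem : ∀ {α β : ℝ}, (⟨α, β⟩ : ℂ) ∈ E' → ∀ {J : A}, J ∈ imaginaryUnits A →
      α • (1 : A) + β • J ∈ C := fun hE _ hJ => hC ▸ ⟨_, _, _, hJ, rfl, hE⟩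
  -- The identity g · f = 1 makes each value of f on C right inverse to a value of g on C;
  -- `to_right` uses f · g = 1 with the roles exchanged.
  have to_left : ∀ x (hx : x ∈ Ω), x ∈ C → ∃ y, ∃ hy : y ∈ f.regularSet, y ∈ C ∧
      g ⟨y, hy⟩ * f ⟨x, hx⟩ = 1 := by
    intro x hx hxC
    obtain ⟨α, β, J, hJ, rfl, hE⟩ : x ∈ circularization A E' := hC ▸ hxC
    obtain ⟨K, hK, h⟩ := exists_mul_eq_one (h2 α β J hJ (hCΩ hxC)).1
      (h2 α β J hJ (hCΩ hxC)).2 hJ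
    refine ⟨_, hCΩ (hmem hE hK), hmem hE hK, ?_⟩
    rw [g.stem_induces α β K hK, f.stem_induces α β J hJ]
    exact h
  have to_right : ∀ y (hy : y ∈ f.regularSet), y ∈ C → ∃ x, ∃ hx : x ∈ Ω, x ∈ C ∧
      f ⟨x, hx⟩ * g ⟨y, hy⟩ = 1 := by
    intro y hy hyC
    obtain ⟨α, β, K, hK, rfl, hE⟩ : y ∈ circularization A E' := hC ▸ hyC
    obtain ⟨J, hJ, h⟩ := exists_mul_eq_one (h1 α β K hK hy).1 (h1 α β K hK hy).2 hK
    refine ⟨_, (hCΩ (hmem hE hJ)).1, hmem hE hJ, ?_⟩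
    rw [g.stem_induces α β K hK, f.stem_induces α β J hJ]
    exact h
  refine ⟨fun x hx h0 => ?_, Set.Subset.antisymm ?_ ?_⟩
  · obtain ⟨y, hy, -, h⟩ := to_left x x.2 hx
    rw [show f ⟨(x : A), x.2⟩ = 0 from h0, mul_zero] at h
    exact zero_ne_one h
  · rintro _ ⟨⟨y, hy⟩, hyC, rfl⟩
    obtain ⟨x, hx, hxC, h⟩ := to_right y hy hyC
    exact ⟨⟨x, hx⟩, hxC, (mul_eq_one_inv h).symm⟩
  · rintro _ ⟨⟨x, hx⟩, hxC, rfl⟩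
    obtain ⟨y, hy, hyC, h⟩ := to_left x hx hxC
    exact ⟨⟨y, hy⟩, hyC, mul_eq_one_inv (mul_eq_one_symm h)⟩

end SliceFunction

end Reciprocal

/-! ## The complex numbers, the quaternions and the octonions -/

noncomputable instance : CompositionStarAlgebra ℂ where
  re := Complex.reLm
  re_one := by simp
  self_add_star x := by apply Complex.ext <;> simp; ring
  star_mul_mul x y := by apply Complex.ext <;> simp <;> ring
  re_mul_comm x y := by rw [mul_comm]
  re_mul_assoc x y z := by rw [mul_assoc]
  eq_zero_of_norm x h := by
    apply Complex.ext <;> simp at h ⊢ <;> nlinarith [mul_self_nonneg x.re, mul_self_nonneg x.im]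
  inv_eq x := by
    rw [Complex.inv_def, mul_comm, Complex.real_smul]
    simp [Complex.normSq_apply]

theorem Quaternion.re_mul_comm' (x y : ℍ[ℝ]) : (x * y).re = (y * x).re := by
  simp only [Quaternion.re_mul]; ring

noncomputable instance : CompositionStarAlgebra ℍ[ℝ] where
  re :=
    { toFun := fun x => x.re
      map_add' := fun x y => by simp
      map_smul' := fun r x => by simp }
  re_one := Quaternion.re_one
  self_add_star x := by
    change x + star x = (2 * x.re) • 1
    ext <;> simp; ring
  star_mul_mul x y := by
    change _ = (x * star x).re • y
    rw [← mul_assoc, Quaternion.star_mul_self, Quaternion.self_mul_star,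
      Quaternion.coe_mul_eq_smul, Quaternion.re_coe]
  re_mul_comm x y := Quaternion.re_mul_comm' x y
  re_mul_assoc x y z := by rw [mul_assoc]
  eq_zero_of_norm x h := by
    change (x * star x).re = 0 at h
    rwa [Quaternion.self_mul_star, Quaternion.re_coe, Quaternion.normSq_eq_zero] at h
  inv_eq x := by
    change x⁻¹ = ((x * star x).re)⁻¹ • star x
    rw [Quaternion.self_mul_star, Quaternion.re_coe]
    rfl

namespace Octonion

theorem star_mul_mul (x y : Octonion) : star x * (x * y) = x.normSq • y := by
  ext <;> simp [normSq, Quaternion.normSq_def'] <;> ring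

theorem fst_re_mul_comm (x y : Octonion) : (x * y).fst.re = (y * x).fst.re := by
  simp
  ring

/-- A polynomial identity in the coordinates: octonion associators have zero real part. -/
theorem fst_re_mul_assoc (x y z : Octonion) : (x * y * z).fst.re = (x * (y * z)).fst.re := by
  simp
  ring

theorem fst_re_mul_star (x : Octonion) : (x * star x).fst.re = x.normSq := by
  simp [mul_star_self]

noncomputable instance : CompositionStarAlgebra Octonion where
  re :=
    { toFun := fun x => x.fst.re
      map_add' := fun x y => by simp
      map_smul' := fun r x => by simp }
  re_one := Quaternion.re_one
  self_add_star x := by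
    change x + star x = (2 * x.fst.re) • 1
    ext <;> simp; ring
  star_mul_mul x y := by
    change _ = (x * star x).fst.re • y
    rw [fst_re_mul_star, star_mul_mul]
  re_mul_comm x y := fst_re_mul_comm x y
  re_mul_assoc x y z := fst_re_mul_assoc x y z
  eq_zero_of_norm x h := by
    by_contra hx
    have h1 := mul_inv_cancel hx
    have h2 : x.normSq = 0 := (fst_re_mul_star x).symm.trans h
    rw [inv_def, h2, inv_zero, zero_smul, mul_zero] at h1
    exact zero_ne_one h1
  inv_eq x := by
    change _ = ((x * star x).fst.re)⁻¹ • star x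
    rw [fst_re_mul_star, inv_def]

end Octonion

theorem mainTheorem10 :
    (∀ Ω : Set ℂ, IsCircular Ω → ∀ f : SliceFunction Ω,
      (f.regularSet.Nonempty → ∃! g, f.IsReciprocal g) ∧
      ∀ g, f.IsReciprocal g → ∀ C : Set ℂ, IsCircular C → C.Nonempty → C ⊆ f.regularSet →
        (∀ x : Ω, (x : ℂ) ∈ C → f x ≠ 0) ∧
        g '' {x | (x : ℂ) ∈ C} = (fun x => (f x)⁻¹) '' {x : Ω | (x : ℂ) ∈ C}) ∧
    (∀ Ω : Set ℍ[ℝ], IsCircular Ω → ∀ f : SliceFunction Ω,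
      (f.regularSet.Nonempty → ∃! g, f.IsReciprocal g) ∧
      ∀ g, f.IsReciprocal g → ∀ C : Set ℍ[ℝ], IsCircular C → C.Nonempty → C ⊆ f.regularSet →
        (∀ x : Ω, (x : ℍ[ℝ]) ∈ C → f x ≠ 0) ∧
        g '' {x | (x : ℍ[ℝ]) ∈ C} = (fun x => (f x)⁻¹) '' {x : Ω | (x : ℍ[ℝ]) ∈ C}) ∧
    (∀ Ω : Set Octonion, IsCircular Ω → ∀ f : SliceFunction Ω,
      (f.regularSet.Nonempty → ∃! g, f.IsReciprocal g) ∧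
      ∀ g, f.IsReciprocal g → ∀ C : Set Octonion, IsCircular C → C.Nonempty → C ⊆ f.regularSet →
        (∀ x : Ω, (x : Octonion) ∈ C → f x ≠ 0) ∧
        g '' {x | (x : Octonion) ∈ C} = (fun x => (f x)⁻¹) '' {x : Ω | (x : Octonion) ∈ C}) := by
  exact ⟨fun Ω hΩ f => ⟨fun _ => f.existsUnique_isReciprocal hΩ,
      fun g hg C hC _ => f.isReciprocal_image hΩ g hg C hC⟩,
    fun Ω hΩ f => ⟨fun _ => f.existsUnique_isReciprocal hΩ,
      fun g hg C hC _ => f.isReciprocal_image hΩ g hg C hC⟩,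
    fun Ω hΩ f => ⟨fun _ => f.existsUnique_isReciprocal hΩ,
      fun g hg C hC _ => f.isReciprocal_image hΩ g hg C hC⟩⟩
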